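/- Let $n\ge 0$ be an integer and let $S=\mathbb C[x_0,\dots,x_n]$. For a collection $\mathcal F=\{F_j\}_{j\in J}$ of forms (homogeneous polynomials, possibly of different degrees) in $S$, the simultaneous Waring rank $\operatorname{rk}_{\mathbb C}\mathcal F$ is the minimal integer $r$ for which there are linear forms $L_1,\dots,L_r\in S$ such that every $F_j$ can be written as $F_j=\sum_{k=1}^r\lambda_{j,k}L_k^{\deg F_j}$ with $\lambda_{j,k}\in\mathbb C$; for a single form $F$ write $\operatorname{rk}_{\mathbb C}F=\operatorname{rk}_{\mathbb C}\{F\}$. Let $\mathcal M=\{M_j\}_{j\in J}$ be a finite collection of monomials $$M_j=x_0\,x_1^{a_{1,j}}\cdots x_n^{a_{n,j}},\qquad a_{i,j}\ge 1\ \text{ for all } i\in\{1,\dots,n\},\ j\in J.$$ Assume that $\mathcal M$ is $(1,1)$-free, that is: for every $i\in\{1,\dots,n\}$, if the exponents $a_{i,j}$, $j\in J$, are listed with repetitions in increasing order $a_{i,k_1}\le a_{i,k_2}\le\cdots\le a_{i,k_{|J|}}$, then the multiset of successive differences $a_{i,k_{s+1}}-a_{i,k_s}$ $(1\le s<|J|)$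 contains the number $1$ at most once. For a nonempty subset $K\subseteq J$ let $M_K=\gcd(M_j: j\in K)$. Then $\mathcal M$ and all the monomials $M_K$ admit decompositions as above (so that their ranks are defined), and $$\operatorname{rk}_{\mathbb C}\mathcal M=\sum_{\emptyset\ne K\subseteq J}(-1)^{|K|+1}\operatorname{rk}_{\mathbb C}M_K .$$ -/

import Mathlib

open MvPolynomial

noncomputable section

/-- The forms `F i` (`i : ι`) in `ℂ[x₀, …, xₙ]` can be written simultaneously with `r` linear forms:
there are linear forms `L₁, …, L_r` such that every `F i` is a complex linear combination of
`L₁ ^ d, …, L_r ^ d` with `d = deg (F i)`. The coefficients may depend on `i`, the `L k` may not,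
and the degrees of the `F i` may differ. -/
def HasSimultaneousDecomposition {ι : Type*} {n : ℕ}
    (F : ι → MvPolynomial (Fin (n + 1)) ℂ) (r : ℕ) : Prop :=
  ∃ L : Fin r → MvPolynomial (Fin (n + 1)) ℂ, (∀ k, (L k).IsHomogeneous 1) ∧
    ∀ i, ∃ c : Fin r → ℂ, F i = ∑ k, C (c k) * L k ^ (F i).totalDegree

/-- The simultaneous Waring rank over `ℂ` of a collection of forms. -/
def simultaneousWaringRank {ι : Type*} {n : ℕ}
    (F : ι → MvPolynomial (Fin (n + 1)) ℂ) : ℕ :=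
  sInf {r | HasSimultaneousDecomposition F r}

/-- The Waring rank over `ℂ` of a single form. -/
def waringRank {n : ℕ} (F : MvPolynomial (Fin (n + 1)) ℂ) : ℕ :=
  simultaneousWaringRank (fun _ : Unit => F)

/-- The monomial `x₀ x₁ ^ b₁ ⋯ xₙ ^ bₙ`; the exponent of `x_{i+1}` is `b i`. -/
def starMonomial {n : ℕ} (b : Fin n → ℕ) : MvPolynomial (Fin (n + 1)) ℂ :=
  X 0 * ∏ i : Fin n, X i.succ ^ b i

/-- The greatest common divisor of the monomials `x₀ x₁ ^ (a j 1) ⋯ xₙ ^ (a j n)`, `j ∈ K`: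
each exponent is the minimum over `K`. See `gcdStarMonomial_dvd` and `dvd_gcdStarMonomial`. -/
def gcdStarMonomial {ι : Type*} {n : ℕ} (a : ι → Fin n → ℕ) (K : Finset ι) (hK : K.Nonempty) :
    MvPolynomial (Fin (n + 1)) ℂ :=
  starMonomial (fun i => K.inf' hK (fun j => a j i))

/-- The displayed polynomial is the monomial with exponent vector `(1, b)`. -/
theorem starMonomial_eq_monomial {n : ℕ} (b : Fin n → ℕ) :
    starMonomial b =
      monomial (Finsupp.equivFunOnFinite.symm (Fin.cons 1 b : Fin (n + 1) → ℕ)) 1 := by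
  rw [monomial_eq, Finsupp.prod_fintype _ _ (fun i => pow_zero _), Fin.prod_univ_succ]
  simp [starMonomial]

/-- `gcdStarMonomial` divides each of the monomials. -/
theorem gcdStarMonomial_dvd {ι : Type*} {n : ℕ} (a : ι → Fin n → ℕ) (K : Finset ι)
    (hK : K.Nonempty) {j : ι} (hj : j ∈ K) : gcdStarMonomial a K hK ∣ starMonomial (a j) := by
  unfold gcdStarMonomial starMonomial
  exact mul_dvd_mul_left _ (Finset.prod_dvd_prod_of_dvd _ _ fun i _ =>
    pow_dvd_pow _ (Finset.inf'_le (fun j => a j i) hj))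

/-- Every polynomial dividing all the monomials divides `gcdStarMonomial`. -/
theorem dvd_gcdStarMonomial {ι : Type*} {n : ℕ} (a : ι → Fin n → ℕ) (K : Finset ι)
    (hK : K.Nonempty) (p : MvPolynomial (Fin (n + 1)) ℂ)
    (hp : ∀ j ∈ K, p ∣ starMonomial (a j)) : p ∣ gcdStarMonomial a K hK := by
  obtain ⟨j₀, hj₀⟩ := hK
  have h0 := hp j₀ hj₀
  rw [starMonomial_eq_monomial, dvd_monomial_iff_exists one_ne_zero] at h0
  obtain ⟨m, c, -, hc, rfl⟩ := h0
  unfold gcdStarMonomial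
  rw [starMonomial_eq_monomial, monomial_dvd_monomial]
  refine ⟨Or.inr fun i => ?_, hc⟩
  have key : ∀ j ∈ K, m i ≤ (Fin.cons 1 (a j) : Fin (n + 1) → ℕ) i := by
    intro j hj
    have h1 := hp j hj
    rw [starMonomial_eq_monomial, monomial_dvd_monomial] at h1
    rcases h1.1 with h | h
    · exact absurd h one_ne_zero
    · exact h i
  refine Fin.cases (motive := fun i => (∀ j ∈ K, m i ≤ (Fin.cons 1 (a j) : Fin (n + 1) → ℕ) i) →
    m i ≤ Finsupp.equivFunOnFinite.symm
      (Fin.cons 1 (fun i => K.inf' _ (fun j => a j i)) : Fin (n + 1) → ℕ) i) ?_ ?_ i key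
  · intro h
    simpa using h j₀ hj₀
  · intro i h
    simp only [Finsupp.equivFunOnFinite_symm_apply_apply, Fin.cons_succ] at h ⊢
    exact Finset.le_inf' _ _ h

/-- The values of `e`, listed in increasing order with repetitions. -/
def sortedExponents {ι : Type*} [Fintype ι] (e : ι → ℕ) : List ℕ :=
  (Finset.univ.val.map e).sort (· ≤ ·)

/-- The differences of successive elements of the sorted list of the values of `e`. -/
def successiveDifferences {ι : Type*} [Fintype ι] (e : ι → ℕ) : List ℕ :=
  List.zipWith (fun x y => y - x) (sortedExponents e) (sortedExponents e).tail

/-- The collection of the monomials `x₀ x₁ ^ (a j 1) ⋯ xₙ ^ (a j n)` is `(1,1)`-free: for each of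
the variables `x₁, …, xₙ`, among the successive differences of the sorted exponents of this variable
the number `1` occurs at most once. -/
def IsOneOneFree {ι : Type*} [Fintype ι] {n : ℕ} (a : ι → Fin n → ℕ) : Prop :=
  ∀ i : Fin n, (successiveDifferences (fun j => a j i)).count 1 ≤ 1

end

/-! Both sides count the exponent vectors `b` lying below some `a j`, a union of boxes. Lower bound
(`card_exponentUnion_le`): with fewer linear forms than such `b`, a nonzero polynomial supported on
the union vanishes at the points of all forms with nonzero `x₀`-coefficient. Homogenized, and
multiplied by `x₀` to cover the remaining forms and by a monomial, it pairs by apolarity to zero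
with one `M_j`, yet the pairing isolates a nonzero coefficient. Upper bound
(`exists_starMonomial_eq_sum`): each `M_j` is an iterated divided difference over a grid. The single
factor `x₀` lets an exponent exceed its target by one, and this error vanishes when the nodes sum to
zero. One node sequence per variable must serve all `j`; being `(1,1)`-free leaves at most one
forced zero node, so distinct nodes exist. The boxes of `M_j`, `j ∈ K`, meet in the box of `M_K`, so
inclusion-exclusion concludes. -/

open Finset in
/-- The exponents not exceeding at least one of the exponent vectors `a j`. -/
def exponentUnion {ι : Type*} [Fintype ι] {n : ℕ} (a : ι → Fin n → ℕ) : Finset (Fin n → ℕ) :=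
  univ.biUnion fun j => Fintype.piFinset fun i => range (a j i + 1)

theorem mem_exponentUnion {ι : Type*} [Fintype ι] {n : ℕ} {a : ι → Fin n → ℕ} {b : Fin n → ℕ} :
    b ∈ exponentUnion a ↔ ∃ j, b ≤ a j := by
  simp [exponentUnion, Fintype.mem_piFinset, Pi.le_def]

/-- The exponent vector `(c, b)`. -/
noncomputable def consExponent {n : ℕ} (c : ℕ) (b : Fin n → ℕ) : Fin (n + 1) →₀ ℕ :=
  Finsupp.equivFunOnFinite.symm (Fin.cons c b : Fin (n + 1) → ℕ)

@[simp]
theorem consExponent_zero {n : ℕ} (c : ℕ) (b : Fin n → ℕ) : consExponent c b 0 = c := rfl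

@[simp]
theorem consExponent_succ {n : ℕ} (c : ℕ) (b : Fin n → ℕ) (i : Fin n) :
    consExponent c b i.succ = b i := rfl

theorem consExponent_sum {n : ℕ} (c : ℕ) (b : Fin n → ℕ) :
    ((consExponent c b).sum fun _ m => m) = c + ∑ i, b i := by
  rw [Finsupp.sum_fintype _ _ (fun _ => rfl), Fin.sum_univ_succ]
  simp

theorem consExponent_prod {n : ℕ} (c : ℕ) (b : Fin n → ℕ) (l : Fin (n + 1) → ℂ) :
    ((consExponent c b).prod fun i m => l i ^ m) = l 0 ^ c * ∏ i : Fin n, l i.succ ^ b i := by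
  rw [Finsupp.prod_fintype _ _ (fun _ => pow_zero _), Fin.prod_univ_succ]
  simp

theorem consExponent_inj {n : ℕ} {c c' : ℕ} {b b' : Fin n → ℕ} :
    consExponent c b = consExponent c' b' ↔ c = c' ∧ b = b' := by
  simp [consExponent, Fin.cons_inj]

theorem exists_consExponent_eq {n : ℕ} (s : Fin (n + 1) →₀ ℕ) : ∃ c b, s = consExponent c b :=
  ⟨s 0, fun i => s i.succ, by ext i; refine Fin.cases ?_ (fun i => ?_) i <;> simp⟩

theorem starMonomial_eq {n : ℕ} (b : Fin n → ℕ) :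
    starMonomial b = monomial (consExponent 1 b) 1 := starMonomial_eq_monomial b

theorem totalDegree_starMonomial {n : ℕ} (b : Fin n → ℕ) :
    (starMonomial b).totalDegree = 1 + ∑ i, b i := by
  rw [starMonomial_eq, totalDegree_monomial _ one_ne_zero]
  exact consExponent_sum 1 b

theorem multinomial_ne_zero {σ : Type*} (s : σ →₀ ℕ) : (s.multinomial : ℂ) ≠ 0 :=
  Nat.cast_ne_zero.2 (Nat.multinomial_pos _ _).ne'

/-- A linear form is a combination of the variables. -/
theorem exists_eq_sum_smul_X {n : ℕ} {L : MvPolynomial (Fin n) ℂ} (hL : L.IsHomogeneous 1) :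
    ∃ l : Fin n → ℂ, L = ∑ i, l i • X i := by
  have h : L ∈ homogeneousSubmodule (Fin n) ℂ 1 := hL
  rw [homogeneousSubmodule_one_eq_span_X, Submodule.mem_span_range_iff_exists_fun] at h
  obtain ⟨l, hl⟩ := h
  exact ⟨l, hl.symm⟩

theorem coeff_sum_smul_X_pow {n : ℕ} (l : Fin (n + 1) → ℂ) (c : ℕ) (b : Fin n → ℕ) (m : ℕ)
    (hm : c + ∑ i, b i = m) :
    coeff (consExponent c b) ((∑ i, l i • X i : MvPolynomial (Fin (n + 1)) ℂ) ^ m) =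
      (consExponent c b).multinomial * (l 0 ^ c * ∏ i : Fin n, l i.succ ^ b i) := by
  rw [coeff_linearCombination_X_pow_of_fintype, consExponent_sum, if_pos hm, consExponent_prod]

/-! ### Lower bound by apolarity -/

/-- A simultaneous decomposition has at least as many summands as there are exponents in
`exponentUnion a`. -/
theorem card_exponentUnion_le {ι : Type*} [Fintype ι] {n : ℕ} (a : ι → Fin n → ℕ) {r : ℕ}
    (h : HasSimultaneousDecomposition (fun j => starMonomial (a j)) r) :
    (exponentUnion a).card ≤ r := by
  obtain ⟨L, hL, hF⟩ := h
  choose l hl using fun k => exists_eq_sum_smul_X (hL k)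
  by_contra! hr
  -- Evaluation at the dehomogenized points; where `l k 0 = 0` the quotients are the default `0`,
  -- and these values are not used.
  let T : (exponentUnion a → ℂ) →ₗ[ℂ] (Fin r → ℂ) :=
    LinearMap.pi fun k => ∑ b : exponentUnion a,
      (∏ i : Fin n, (l k i.succ / l k 0) ^ b.1 i) • LinearMap.proj b
  have hT : LinearMap.ker T ≠ ⊥ := LinearMap.ker_ne_bot_of_finrank_lt (by simpa using hr)
  obtain ⟨f, hfT, hf0⟩ := (Submodule.ne_bot_iff _).1 hT
  let S : Finset (exponentUnion a) := Finset.univ.filter fun b => f b ≠ 0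
  have hS : S.Nonempty := by
    obtain ⟨b, hb⟩ := Function.ne_iff.1 hf0
    exact ⟨b, by simpa [S] using hb⟩
  -- A term of top degree, so that homogenizing to degree `d` leaves `b` without an extra power of
  -- `x₀`.
  obtain ⟨b, hbS, hmax⟩ := S.exists_max_image (fun b => ∑ i, b.1 i) hS
  have hfb : f b ≠ 0 := by simpa [S] using hbS
  obtain ⟨j, hj⟩ := mem_exponentUnion.1 b.2
  obtain ⟨c, hc⟩ := hF j
  let d := ∑ i, b.1 i
  have hT' : ∀ k, ∑ e ∈ S, f e * ∏ i : Fin n, (l k i.succ / l k 0) ^ e.1 i = 0 := by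
    intro k
    have h1 := congrFun (LinearMap.mem_ker.1 hfT) k
    simp only [T, LinearMap.pi_apply, LinearMap.sum_apply, LinearMap.smul_apply,
      LinearMap.proj_apply, smul_eq_mul, Pi.zero_apply] at h1
    rw [← h1, Finset.sum_filter_of_ne]
    · exact Finset.sum_congr rfl fun _ _ => mul_comm _ _
    · intro e _ he h0
      exact he (by rw [h0, zero_mul])
  -- The extra `1` in the exponent of `x₀` makes this hold also when `l k 0 = 0`.
  have hhom : ∀ k, ∑ e ∈ S, f e * (l k 0 ^ (1 + (d - ∑ i, e.1 i)) *
      ∏ i : Fin n, l k i.succ ^ e.1 i) = 0 := by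
    intro k
    by_cases h0 : l k 0 = 0
    · exact Finset.sum_eq_zero fun e _ => by simp [h0]
    · rw [← mul_zero (l k 0 ^ (1 + d)), ← hT' k, Finset.mul_sum]
      refine Finset.sum_congr rfl fun e he => ?_
      have hle : ∑ i, e.1 i ≤ d := hmax e he
      simp only [div_pow, Finset.prod_div_distrib, Finset.prod_pow_eq_pow_sum]
      rw [show 1 + d = (1 + (d - ∑ i, e.1 i)) + ∑ i, e.1 i by omega, pow_add (l k 0)]
      field_simp
      ring
  -- Multiplying by `x ^ (a j - b)` reaches the degree of the monomial and moves the term `b` to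
  -- `(1, a j)`.
  let g : exponentUnion a → Fin (n + 1) →₀ ℕ := fun e =>
    consExponent (1 + (d - ∑ i, e.1 i)) (e.1 + (a j - b.1))
  have hsum : ∀ e ∈ S, 1 + (d - ∑ i, e.1 i) + ∑ i, (e.1 + (a j - b.1)) i = 1 + ∑ i, a j i := by
    intro e he
    have hle : ∑ i, e.1 i ≤ d := hmax e he
    have h2 : ∑ i, (a j - b.1) i + d = ∑ i, a j i := by
      rw [← Finset.sum_add_distrib]
      exact Finset.sum_congr rfl fun i _ => Nat.sub_add_cancel (hj i)
    simp only [Pi.add_apply, Finset.sum_add_distrib]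
    omega
  -- The apolar pairing: after division by multinomials, pairing with a power of a linear form is
  -- evaluation at its coefficients.
  have hzero : ∑ e ∈ S, f e / (g e).multinomial * coeff (g e) (starMonomial (a j)) = 0 := by
    rw [show starMonomial (a j) = _ from hc]
    simp only [coeff_sum, coeff_C_mul, Finset.mul_sum]
    rw [Finset.sum_comm]
    refine Finset.sum_eq_zero fun k _ => ?_
    rw [← mul_zero (c k * ∏ i : Fin n, l k i.succ ^ (a j - b.1) i), ← hhom k, Finset.mul_sum]
    refine Finset.sum_congr rfl fun e he => ?_
    rw [totalDegree_starMonomial, hl k, coeff_sum_smul_X_pow _ _ _ _ (hsum e he)]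
    have hne := multinomial_ne_zero (g e)
    simp only [Pi.add_apply, pow_add _ (e.1 _), Finset.prod_mul_distrib]
    change f e / (g e).multinomial * (c k * ((g e).multinomial * _)) = _
    field_simp
  rw [Finset.sum_eq_single_of_mem b hbS] at hzero
  · have hg : g b = consExponent 1 (a j) := by
      simp only [g, consExponent_inj]
      refine ⟨by omega, ?_⟩
      funext i
      exact Nat.add_sub_cancel' (hj i)
    rw [hg, starMonomial_eq, coeff_monomial, if_pos rfl, mul_one] at hzero
    exact div_ne_zero hfb (multinomial_ne_zero _) hzero
  · intro e _ heb
    rw [starMonomial_eq, coeff_monomial, if_neg, mul_zero]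
    intro h
    refine heb (Subtype.ext (funext fun i => ?_))
    have h1 := congrFun (consExponent_inj.1 h).2 i
    have h2 := hj i
    change a j i = e.1 i + (a j i - b.1 i) at h1
    change b.1 i ≤ a j i at h2
    omega

/-! ### Upper bound by interpolation on a grid -/

open Finset in
/-- Weights on the nodes `t 0, …, t m` extracting the coefficient of degree `m` from polynomials of
degree at most `m + 1`, provided that the nodes have sum zero. -/
theorem exists_coeff_weights {t : ℕ → ℂ} (ht : Function.Injective t) {m : ℕ}
    (hsum : ∑ k ∈ range (m + 1), t k = 0) :
    ∃ w : ℕ → ℂ, ∀ b ≤ m + 1, ∑ k ∈ range (m + 1), w k * t k ^ b = if b = m then 1 else 0 := by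
  have key (P : Polynomial ℂ) (hP : P.degree < (m + 1 : ℕ)) :
      ∑ k ∈ range (m + 1), (∏ l ∈ (range (m + 1)).erase k, (t k - t l))⁻¹ * P.eval (t k) =
        P.coeff m := by
    have h := Lagrange.coeff_eq_sum (s := range (m + 1)) (v := t) ht.injOn (P := P) (by simpa)
    rw [card_range, Nat.add_sub_cancel] at h
    rw [h]
    exact sum_congr rfl fun k _ => by rw [div_eq_inv_mul]
  refine ⟨fun k => (∏ l ∈ (range (m + 1)).erase k, (t k - t l))⁻¹, fun b hb => ?_⟩
  rcases hb.lt_or_eq with hb | rfl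
  · have h := key (Polynomial.X ^ b) (by
      rw [Polynomial.degree_X_pow]; exact_mod_cast hb)
    simpa [Polynomial.coeff_X_pow, eq_comm] using h
  -- In degree `m + 1`, `X ^ (m + 1)` is reduced modulo the nodal polynomial `Q`, whose coefficient
  -- at `X ^ m` is minus the sum of the nodes.
  · let Q : Polynomial ℂ := ∏ k ∈ range (m + 1), (Polynomial.X - Polynomial.C (t k))
    have hQ : Q.Monic := Polynomial.monic_prod_of_monic _ _ fun k _ => Polynomial.monic_X_sub_C _
    have hQd : Q.degree = (m + 1 : ℕ) := by simp [Q, Polynomial.degree_prod]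
    have hlt : (Polynomial.X ^ (m + 1) - Q).degree < ((m + 1 : ℕ) : WithBot ℕ) := by
      have := Polynomial.degree_sub_lt_left (p := (Polynomial.X ^ (m + 1) : Polynomial ℂ)) (q := Q)
        (by rw [hQd, Polynomial.degree_X_pow]) (by simp) (by rw [hQ.leadingCoeff]; simp)
      rw [Polynomial.degree_X_pow] at this
      exact_mod_cast this
    have h := key _ hlt
    have hc : Q.coeff m = 0 := by
      have := Polynomial.prod_X_sub_C_coeff_card_pred (range (m + 1)) t (by simp)
      rwa [card_range, Nat.add_sub_cancel, hsum, neg_zero] at this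
    rw [Polynomial.coeff_sub, hc, Polynomial.coeff_X_pow, if_neg (by omega), sub_zero] at h
    rw [if_neg (by omega), ← h]
    refine sum_congr rfl fun k hk => ?_
    have : Q.eval (t k) = 0 := by
      rw [Polynomial.eval_prod]
      exact prod_eq_zero hk (by simp)
    simp [this]

/-- The linear form `x₀ + p₁ x₁ + ⋯ + pₙ xₙ`. -/
noncomputable def affineForm {n : ℕ} (p : Fin n → ℂ) : MvPolynomial (Fin (n + 1)) ℂ :=
  ∑ i, (Fin.cons 1 p : Fin (n + 1) → ℂ) i • X i

theorem isHomogeneous_affineForm {n : ℕ} (p : Fin n → ℂ) : (affineForm p).IsHomogeneous 1 :=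
  IsHomogeneous.sum _ _ _ fun i _ => by
    rw [smul_eq_C_mul]
    exact isHomogeneous_C_mul_X _ _

open Finset in
/-- The monomial `x₀ x ^ b` is a combination of powers of the linear forms belonging to the points
of the grid with nodes `t i 0, …, t i (b i)`. -/
theorem exists_starMonomial_eq_sum {n : ℕ} {t : Fin n → ℕ → ℂ}
    (ht : ∀ i, Function.Injective (t i)) {b : Fin n → ℕ}
    (hsum : ∀ i, ∑ k ∈ range (b i + 1), t i k = 0) :
    ∃ c : (Fin n → ℕ) → ℂ, starMonomial b =
      ∑ e ∈ Fintype.piFinset fun i => range (b i + 1),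
        C (c e) * affineForm (fun i => t i (e i)) ^ (1 + ∑ i, b i) := by
  choose w hw using fun i => exists_coeff_weights (ht i) (hsum i)
  refine ⟨fun e => ((consExponent 1 b).multinomial : ℂ)⁻¹ * ∏ i, w i (e i), ?_⟩
  ext s
  obtain ⟨d, β, rfl⟩ := exists_consExponent_eq s
  simp only [coeff_sum, coeff_C_mul]
  rw [starMonomial_eq, coeff_monomial]
  by_cases hd : d + ∑ i, β i = 1 + ∑ i, b i
  · have hmoment : ∑ e ∈ Fintype.piFinset fun i => range (b i + 1),
        (∏ i, w i (e i)) * ∏ i, t i (e i) ^ β i = if β = b then 1 else 0 := by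
      simp only [← prod_mul_distrib]
      rw [← prod_univ_sum (fun i => range (b i + 1)) (fun i k => w i k * t i k ^ β i)]
      by_cases hlow : ∃ i, β i < b i
      · obtain ⟨i, hi⟩ := hlow
        rw [if_neg (by rintro rfl; exact hi.false)]
        refine prod_eq_zero (mem_univ i) ?_
        rw [hw i _ (by omega), if_neg hi.ne]
      · push Not at hlow
        -- The total excess of `β` over `b` is `1 - d`, hence at most one.
        have hup : ∀ i, β i ≤ b i + 1 := by
          intro i
          by_contra! hi
          have h1 : ∑ k, b k + 1 < ∑ k, β k := by
            rw [← add_sum_erase univ b (mem_univ i), ← add_sum_erase univ β (mem_univ i)]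
            have := sum_le_sum fun k (_ : k ∈ univ.erase i) => hlow k
            omega
          omega
        rw [prod_congr rfl fun i _ => hw i _ (hup i)]
        split_ifs with h
        · exact prod_eq_one fun i _ => by rw [h, if_pos rfl]
        · obtain ⟨i, hi⟩ := Function.ne_iff.1 h
          exact prod_eq_zero (mem_univ i) (if_neg hi)
    have hcoeff : ∀ e : Fin n → ℕ, coeff (consExponent d β)
        (affineForm (fun i => t i (e i)) ^ (1 + ∑ i, b i)) =
        (consExponent d β).multinomial * ∏ i, t i (e i) ^ β i := by
      intro e
      rw [affineForm, coeff_sum_smul_X_pow _ _ _ _ hd]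
      simp
    have : ∀ e : Fin n → ℕ, ((consExponent 1 b).multinomial : ℂ)⁻¹ * (∏ i, w i (e i)) *
        ((consExponent d β).multinomial * ∏ i, t i (e i) ^ β i) =
        ((consExponent 1 b).multinomial : ℂ)⁻¹ * (consExponent d β).multinomial *
          ((∏ i, w i (e i)) * ∏ i, t i (e i) ^ β i) := fun e => by ring
    simp only [hcoeff, this]
    rw [← mul_sum, hmoment]
    by_cases h : β = b
    · subst h
      obtain rfl : d = 1 := by omega
      rw [inv_mul_cancel₀ (multinomial_ne_zero _)]
      simp
    · rw [if_neg h, if_neg (fun h' => h (consExponent_inj.1 h').2.symm), mul_zero]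
  · rw [if_neg]
    · refine (sum_eq_zero fun e _ => ?_).symm
      rw [affineForm, coeff_linearCombination_X_pow_of_fintype, consExponent_sum, if_neg hd,
        mul_zero]
    · rintro h
      obtain ⟨rfl, rfl⟩ := consExponent_inj.1 h
      exact hd rfl

/-- A collection of monomials has a decomposition supported on the grid points belonging to
`exponentUnion a`, provided that suitable nodes exist. -/
theorem hasSimultaneousDecomposition_card {ι : Type*} [Fintype ι] {n : ℕ} (a : ι → Fin n → ℕ)
    (hnodes : ∀ i, ∃ t : ℕ → ℂ, Function.Injective t ∧
      ∀ j, ∑ k ∈ Finset.range (a j i + 1), t k = 0) :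
    HasSimultaneousDecomposition (fun j => starMonomial (a j)) (exponentUnion a).card := by
  classical
  choose t ht hsum using hnodes
  let p : exponentUnion a → MvPolynomial (Fin (n + 1)) ℂ := fun e => affineForm fun i => t i (e.1 i)
  let E := (exponentUnion a).equivFin
  refine ⟨fun k => p (E.symm k), fun k => isHomogeneous_affineForm _, fun j => ?_⟩
  obtain ⟨c, hc⟩ := exists_starMonomial_eq_sum ht (fun i => hsum i j)
  refine ⟨fun k => if (E.symm k).1 ≤ a j then c (E.symm k).1 else 0, ?_⟩
  rw [totalDegree_starMonomial,
    Equiv.sum_comp E.symm (fun e => C (if e.1 ≤ a j then c e.1 else 0) * p e ^ (1 + ∑ i, a j i)),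
    Finset.sum_coe_sort (exponentUnion a) (fun e => C (if e ≤ a j then c e else 0) *
      affineForm (fun i => t i (e i)) ^ (1 + ∑ i, a j i))]
  refine hc.trans ?_
  have hbox : ∀ e, e ∈ Fintype.piFinset (fun i => Finset.range (a j i + 1)) ↔ e ≤ a j := by
    simp [Fintype.mem_piFinset, Pi.le_def]
  symm
  rw [← Finset.sum_subset (s₁ := Fintype.piFinset fun i => Finset.range (a j i + 1))]
  · refine Finset.sum_congr rfl fun e he => ?_
    rw [if_pos ((hbox e).1 he)]
  · exact fun e he => mem_exponentUnion.2 ⟨j, (hbox e).1 he⟩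
  · intro e _ he
    rw [if_neg (fun h => he ((hbox e).2 h)), C_0, zero_mul]

theorem simultaneousWaringRank_eq_card {ι : Type*} [Fintype ι] {n : ℕ} (a : ι → Fin n → ℕ)
    (hnodes : ∀ i, ∃ t : ℕ → ℂ, Function.Injective t ∧
      ∀ j, ∑ k ∈ Finset.range (a j i + 1), t k = 0) :
    simultaneousWaringRank (fun j => starMonomial (a j)) = (exponentUnion a).card :=
  le_antisymm (Nat.sInf_le (hasSimultaneousDecomposition_card a hnodes))
    (le_csInf ⟨_, hasSimultaneousDecomposition_card a hnodes⟩ fun _ h => card_exponentUnion_le a h)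

/-! ### Construction of the nodes -/

/-- Distinct nodes whose partial sums vanish at prescribed places. -/
theorem exists_injective_partialSum_eq_zero {A : Set ℕ} (hpos : ∀ m ∈ A, 1 ≤ m)
    (hA : ∀ v w, v ∈ A → v + 1 ∈ A → w ∈ A → w + 1 ∈ A → v = w) :
    ∃ t : ℕ → ℂ, Function.Injective t ∧ ∀ m ∈ A, ∑ k ∈ Finset.range (m + 1), t k = 0 := by
  classical
  -- The partial sums are chosen first, the nodes being their differences: `0`, `3 * 4 ^ k`, `4 ^ (k
  -- + 1)` or `-4 ^ k`. The growth separates each nonzero node from all earlier ones, so only the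
  -- value `0` could repeat.
  let s : ℕ → ℤ := fun m => if m = 0 ∨ m - 1 ∈ A then 0 else 4 ^ m
  let t : ℕ → ℤ := fun k => s (k + 1) - s k
  have hs : ∀ m, s m = 0 ∨ s m = 4 ^ m := fun m => by
    simp only [s]; split_ifs <;> simp
  have hs0 : ∀ m, s m = 0 → m = 0 ∨ m - 1 ∈ A := fun m h => by
    by_contra h'
    simp only [s, if_neg h'] at h
    exact pow_ne_zero m (by norm_num) h
  have htzero : ∀ k, t k = 0 → 1 ≤ k ∧ k - 1 ∈ A ∧ k ∈ A := by
    intro k hk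
    have h4 : (0 : ℤ) < 4 ^ k := by positivity
    have h41 : (4 : ℤ) ^ (k + 1) = 4 * 4 ^ k := by ring
    have hk' : s (k + 1) = 0 ∧ s k = 0 := by
      change s (k + 1) - s k = 0 at hk
      rcases hs k with h | h <;> rcases hs (k + 1) with h' | h' <;> omega
    have h1 : k ∈ A := by simpa using hs0 _ hk'.1
    have h2 := hpos k h1
    refine ⟨h2, ?_, h1⟩
    rcases hs0 _ hk'.2 with h | h
    · omega
    · exact h
  have hlt : ∀ k l, k < l → t k ≠ t l := by
    intro k l hkl heq
    have hk4 : (0 : ℤ) < 4 ^ k := by positivity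
    have hk41 : (4 : ℤ) ^ (k + 1) = 4 * 4 ^ k := by ring
    have hl41 : (4 : ℤ) ^ (l + 1) = 4 * 4 ^ l := by ring
    have hle : (4 : ℤ) ^ (k + 1) ≤ 4 ^ l := pow_le_pow_right₀ (by norm_num) hkl
    have hl : t l = 0 := by
      rcases hs k with h1 | h1 <;> rcases hs (k + 1) with h2 | h2 <;>
        rcases hs l with h3 | h3 <;> rcases hs (l + 1) with h4 | h4 <;>
        simp only [t, h1, h2, h3, h4, hl41] at heq ⊢ <;> omega
    obtain ⟨hk1, hk2, hk3⟩ := htzero k (heq.trans hl)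
    obtain ⟨hl1, hl2, hl3⟩ := htzero l hl
    have := hA (k - 1) (l - 1) hk2 (by rwa [Nat.sub_add_cancel hk1]) hl2
      (by rwa [Nat.sub_add_cancel hl1])
    omega
  refine ⟨fun k => (t k : ℂ), ?_, fun m hm => ?_⟩
  · refine Int.cast_injective.comp fun k l h => ?_
    rcases lt_trichotomy k l with hkl | hkl | hkl
    · exact absurd h (hlt k l hkl)
    · exact hkl
    · exact absurd h.symm (hlt l k hkl)
  · rw [← Int.cast_sum, Finset.sum_range_sub]
    simp [s, hm]

/-- In a sorted list there are at most as many pairs of consecutive values as there are successive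
differences equal to one. -/
theorem card_filter_succ_mem_le_count (l : List ℕ) (hl : l.Pairwise (· ≤ ·)) :
    (l.toFinset.filter fun v => v + 1 ∈ l).card ≤
      (List.zipWith (fun x y => y - x) l l.tail).count 1 := by
  induction l with
  | nil => simp
  | cons x l ih =>
    cases l with
    | nil => simp
    | cons y l =>
      obtain ⟨hx, hl'⟩ := List.pairwise_cons.1 hl
      have ih := ih hl'
      have hy := (List.pairwise_cons.1 hl').1
      have hsub : ((x :: y :: l).toFinset.filter fun v => v + 1 ∈ x :: y :: l) ⊆
          (if y - x = 1 then {x} else ∅) ∪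
            ((y :: l).toFinset.filter fun v => v + 1 ∈ y :: l) := by
        intro v hv
        rw [Finset.mem_filter, List.mem_toFinset] at hv
        rw [Finset.mem_union, Finset.mem_filter, List.mem_toFinset]
        obtain ⟨hv1, hv2⟩ := hv
        have hxv : x ≤ v := by
          rcases List.mem_cons.1 hv1 with h | h
          · exact h.ge
          · exact hx v h
        have hv3 : v + 1 ∈ y :: l := (List.mem_cons.1 hv2).resolve_left (by omega)
        -- A pair whose lower value occurs in the tail is counted there; otherwise sortedness forces
        -- `y = x + 1`.
        by_cases hv4 : v ∈ y :: l
        · exact Or.inr ⟨hv4, hv3⟩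
        · obtain rfl : v = x := (List.mem_cons.1 hv1).resolve_right hv4
          have hyv : y ≤ v + 1 := by
            rcases List.mem_cons.1 hv3 with h | h
            · exact h.ge
            · exact hy _ h
          have hvy := hx y List.mem_cons_self
          have : y ≠ v := fun h => hv4 (h ▸ List.mem_cons_self)
          left
          rw [if_pos (by omega)]
          exact Finset.mem_singleton_self _
      refine (Finset.card_le_card hsub).trans ((Finset.card_union_le _ _).trans ?_)
      simp only [List.tail_cons, List.zipWith_cons_cons, List.count_cons] at ih ⊢
      split_ifs with h <;> (simp_all; try omega)

theorem IsOneOneFree.eq_of_succ {ι : Type*} [Fintype ι] {n : ℕ} {a : ι → Fin n → ℕ}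
    (hfree : IsOneOneFree a) (i : Fin n) (v w : ℕ) (hv : v ∈ Set.range fun j => a j i)
    (hv' : v + 1 ∈ Set.range fun j => a j i) (hw : w ∈ Set.range fun j => a j i)
    (hw' : w + 1 ∈ Set.range fun j => a j i) : v = w := by
  have hmem : ∀ x, x ∈ sortedExponents (fun j => a j i) ↔ x ∈ Set.range fun j => a j i := by
    intro x
    simp [sortedExponents]
  have h := (card_filter_succ_mem_le_count (sortedExponents fun j => a j i)
    (Multiset.pairwise_sort _ _)).trans (hfree i)
  refine Finset.card_le_one.1 h v ?_ w ?_ <;>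
    simp only [Finset.mem_filter, List.mem_toFinset, hmem] <;> constructor <;> assumption

theorem exists_nodes {ι : Type*} [Fintype ι] {n : ℕ} {a : ι → Fin n → ℕ}
    (ha : ∀ j i, 1 ≤ a j i) (hfree : IsOneOneFree a) (i : Fin n) :
    ∃ t : ℕ → ℂ, Function.Injective t ∧ ∀ j, ∑ k ∈ Finset.range (a j i + 1), t k = 0 := by
  obtain ⟨t, ht, hsum⟩ := exists_injective_partialSum_eq_zero
    (A := Set.range fun j => a j i) (by rintro _ ⟨j, rfl⟩; exact ha j i) (hfree.eq_of_succ i)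
  exact ⟨t, ht, fun j => hsum _ ⟨j, rfl⟩⟩

/-! ### Single monomials and inclusion-exclusion -/

theorem isOneOneFree_unit {n : ℕ} (b : Fin n → ℕ) : IsOneOneFree fun _ : Unit => b := by
  intro i
  simp [successiveDifferences, sortedExponents]

theorem exponentUnion_unit {n : ℕ} (b : Fin n → ℕ) :
    exponentUnion (fun _ : Unit => b) = Fintype.piFinset fun i => Finset.range (b i + 1) := by
  simp [exponentUnion]

/-- The Waring rank of the monomial `x₀ x₁ ^ b₁ ⋯ xₙ ^ bₙ`, as the size of a box. -/
theorem waringRank_starMonomial {n : ℕ} (b : Fin n → ℕ) (hb : ∀ i, 1 ≤ b i) :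
    waringRank (starMonomial b) =
      (Fintype.piFinset fun i => Finset.range (b i + 1)).card := by
  rw [← exponentUnion_unit]
  exact simultaneousWaringRank_eq_card _ (exists_nodes (fun _ => hb) (isOneOneFree_unit b))

theorem inf'_piFinset_range {ι : Type*} {n : ℕ} (a : ι → Fin n → ℕ) (K : Finset ι)
    (hK : K.Nonempty) :
    K.inf' hK (fun j => Fintype.piFinset fun i => Finset.range (a j i + 1)) =
      Fintype.piFinset fun i => Finset.range (K.inf' hK (fun j => a j i) + 1) := by
  ext e
  rw [Finset.mem_inf']
  simp only [Fintype.mem_piFinset, Finset.mem_range, Nat.lt_succ_iff, Finset.le_inf'_iff]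
  exact ⟨fun h i j hj => h j hj i, fun h j hj i => h i j hj⟩

theorem mainTheorem3 {ι : Type*} [Fintype ι] (n : ℕ) (a : ι → Fin n → ℕ)
    (ha : ∀ j i, 1 ≤ a j i) (hfree : IsOneOneFree a) :
    (∃ r, HasSimultaneousDecomposition (fun j => starMonomial (a j)) r) ∧
    (∀ K : {K : Finset ι // K.Nonempty},
      ∃ r, HasSimultaneousDecomposition (fun _ : Unit => gcdStarMonomial a K.1 K.2) r) ∧
    (simultaneousWaringRank (fun j => starMonomial (a j)) : ℤ) =
      ∑ K : {K : Finset ι // K.Nonempty},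
        (-1 : ℤ) ^ (K.1.card + 1) * (waringRank (gcdStarMonomial a K.1 K.2) : ℤ) := by

  have hinf : ∀ (K : Finset ι) (hK : K.Nonempty) (i : Fin n), 1 ≤ K.inf' hK (fun j => a j i) :=
    fun K hK i => Finset.le_inf' _ _ fun j _ => ha j i
  have hnodes := exists_nodes ha hfree
  refine ⟨⟨_, hasSimultaneousDecomposition_card a hnodes⟩, fun K => ⟨_,
    hasSimultaneousDecomposition_card (fun _ : Unit => fun i => K.1.inf' K.2 (fun j => a j i))
      (exists_nodes (fun _ => hinf K.1 K.2) (isOneOneFree_unit _))⟩, ?_⟩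
  rw [simultaneousWaringRank_eq_card a hnodes, exponentUnion,
    Finset.inclusion_exclusion_card_biUnion]
  refine Fintype.sum_equiv (Equiv.subtypeEquivRight (by simp)) _ _ fun K => ?_
  have hK : K.1.Nonempty := (Finset.mem_filter.1 K.2).2
  change _ = (-1 : ℤ) ^ (K.1.card + 1) * (waringRank (gcdStarMonomial a K.1 hK) : ℤ)
  rw [gcdStarMonomial, waringRank_starMonomial _ (hinf K.1 hK), inf'_piFinset_range]
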